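/- **Setting.** For $\ell\ge 0$ let $X_\ell=\{0,1,\dots,2^\ell-1\}$, identified with the set of bit strings of length $\ell$; $\oplus$ is bitwise exclusive or. A real sequence $\varepsilon(\ell)$ is *negligible* if $\ell^c\varepsilon(\ell)\to 0$ for every $c\in\mathbb N$. Adversaries are randomized and computationally unbounded. - Two families $(F_\ell)$, $(F'_\ell)$ of random functions $X_\ell\to X_\ell$ are *indistinguishable* if, for every adversary that adaptively queries an oracle at a number of points polynomial in $\ell=\log_2|X_\ell|$ and then outputs a bit, the probabilities of output $1$ with oracle $F_\ell$ and with oracle $F'_\ell$ differ by a negligible amount. $(F_\ell)$ is *pseudorandom* if it is indistinguishable from uniformly random functions $X_\ell\to X_\ell$. - Random sequences in finite sets $Y_\ell$ are *pseudorandom* if for every polynomially bounded $m(\ell)$ every distinguisher that is given the first $m(\ell)$ terms has negligible advantage in telling them from $m(\ell)$ independent uniform elements of $Y_\ell$. - For $g:X_\ell\to X_\ell$ the *Feistel permutation* is $D_g(L,R)=(R,\,L\oplus g(R))$. - A *Latin square operation* on $X$ is $\star:X\times X\to X$ such that all maps $a\star\cdot$ and $\cdot\star b$ are bijections (for example addition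 modulo $2^\ell$ on $X_\ell$). The *two-step counter-assisted generator* with iteration function $f:X_\ell\to X_\ell$, counter operation $\star$, output function $G:X_\ell^2\to X_\ell^2$ and seed $x_0\in X_\ell$ has states $s_i=(x_{2i},x_{2i+1})$ and outputs $G(s_i)$ for $i\ge 0$, where $$x_{2i+1}=f(x_{2i})\star(i\bmod 2^\ell),\qquad x_{2i+2}=f(x_{2i+1}).$$ **Theorem.** Let $g=(g_\ell)$ be a pseudorandom family of random functions $g_\ell:X_\ell\to X_\ell$. Let $H=(H_\ell)$, where $H_\ell$ is a family of functions $X_\ell\to X_\ell$ with a probability distribution (for instance a finite family with the uniform distribution), such that $$\max_{x\ne y,\;z\in X_\ell}\ \Pr_{h\in H_\ell}\bigl[h(x)\oplus h(y)=z\bigr]$$ is bounded by a negligible function of $\ell$. Let $h=(h_\ell)$ be pseudorandomly chosen from $H$, that is, let $h_\ell$ be a random function $X_\ell\to X_\ell$, independent of $g_\ell$, such that $(h_\ell)$ is indistinguishable from a random choice of an element of $H_\ell$. Then for all Latin square operations $\star_\ell$ on $X_\ell$, all functions $f_\ell:X_\ell\to X_\ell$ and all seeds $x_0^{(\ell)}\in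 X_\ell$, the output sequence in $X_\ell\times X_\ell$ of the two-step counter-assisted generator with iteration function $f_\ell$, counter operation $\star_\ell$, output function $D_{g_\ell}\circ D_{g_\ell}\circ D_{h_\ell}$ and seed $x_0^{(\ell)}$ is pseudorandom. -/

import Mathlib

open Filter Asymptotics

noncomputable section

namespace CounterAssisted

/-- The state space `{0, …, 2 ^ l - 1}`, identified with the bit strings of length `l`:
`+` is addition modulo `2 ^ l` and `^^^` is bitwise exclusive or. -/
abbrev Block (l : ℕ) : Type := BitVec l

instance blockFintype (l : ℕ) : Fintype (Block l) :=
  Fintype.ofEquiv (Fin (2 ^ l))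
    { toFun := BitVec.ofFin
      invFun := BitVec.toFin
      left_inv := fun _ => rfl
      right_inv := fun _ => rfl }

/-! ### Generators -/

/-- A binary operation that is uniquely invertible given its value and any one of its arguments. -/
structure IsLatinSquare {X : Type*} (op : X → X → X) : Prop where
  bijective_left : ∀ a, Function.Bijective fun b => op a b
  bijective_right : ∀ b, Function.Bijective fun a => op a b

/-- The Feistel permutation `D_g (L, R) = (R, L ⊕ g R)`. -/
def feistel {l : ℕ} (g : Block l → Block l) (p : Block l × Block l) : Block l × Block l :=
  (p.2, p.1 ^^^ g p.2)

/-- The two-step iteration function `(a, b) ↦ (f b, f (f b))`. -/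
def twoStepIter {X : Type*} (f : X → X) (s : X × X) : X × X :=
  (f s.2, f (f s.2))

/-- Combining a pair of states with a counter value: `(a, b) ↦ (a, b ⋆ c)`. -/
def addCounter {X : Type*} (op : X → X → X) (s : X × X) (c : X) : X × X :=
  (s.1, op s.2 c)

/-- The state sequence of the two-step counter-assisted generator with iteration function `f`,
counter operation `op` and seed `x₀`. The counter is cyclic: step `i` uses `i` modulo `2 ^ l`.
The `i`-th state is the pair `(x_{2i}, x_{2i+1})` with `x_0 = x₀`,
`x_{2i+1} = f x_{2i} ⋆ i` and `x_{2i+2} = f x_{2i+1}`. -/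
def twoStepState {l : ℕ} (op : Block l → Block l → Block l) (f : Block l → Block l)
    (x₀ : Block l) : ℕ → Block l × Block l
  | 0 => addCounter op (x₀, f x₀) (BitVec.ofNat l 0)
  | i + 1 => addCounter op (twoStepIter f (twoStepState op f x₀ i)) (BitVec.ofNat l (i + 1))

/-- The first `m` outputs of the two-step counter-assisted generator with output function `G`. -/
def twoStepOutput {l : ℕ} (op : Block l → Block l → Block l) (f : Block l → Block l)
    (G : Block l × Block l → Block l × Block l) (x₀ : Block l) (m : ℕ) :
    Fin m → Block l × Block l :=
  fun i => G (twoStepState op f x₀ i)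

/-! ### Indistinguishability

Distinguishers are computationally unbounded. They are limited only by the number of values they
see, which is polynomial in `l`, the logarithm of the size of the state space. -/

/-- A real sequence is negligible if it tends to zero faster than every inverse power of `l`. -/
def Negligible (ε : ℕ → ℝ) : Prop :=
  SuperpolynomialDecay atTop (fun l : ℕ => (l : ℝ)) ε

/-- A deterministic adaptive algorithm that makes at most `q` queries to an oracle `X → Y`, each
depending on the previous answers, and then outputs a bit. -/
inductive OracleAlg (X Y : Type) : ℕ → Type
  | output {q : ℕ} (b : Bool) : OracleAlg X Y q
  | query {q : ℕ} (x : X) (next : Y → OracleAlg X Y q) : OracleAlg X Y (q + 1)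

/-- The bit that the algorithm outputs when its oracle is `φ`. -/
def OracleAlg.run {X Y : Type} (φ : X → Y) : {q : ℕ} → OracleAlg X Y q → Bool
  | _, .output b => b
  | _, .query x next => OracleAlg.run φ (next (φ x))

/-- The probability that a randomized algorithm `A` (a random choice of a deterministic one)
outputs `true` when its oracle is drawn from `F`, independently of the coins of `A`. -/
def acceptProb {X Y : Type} {q : ℕ} (A : PMF (OracleAlg X Y q)) (F : PMF (X → Y)) : ℝ :=
  ((A.bind fun a => F.map fun φ => a.run φ) true).toReal

/-- Two families of random functions cannot be told apart, except with negligible advantage, by any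
randomized adaptive adversary making polynomially many queries. -/
def FunIndist (F F' : ∀ l : ℕ, PMF (Block l → Block l)) : Prop :=
  ∀ (p : Polynomial ℕ) (A : ∀ l : ℕ, PMF (OracleAlg (Block l) (Block l) (p.eval l))),
    Negligible fun l => |acceptProb (A l) (F l) - acceptProb (A l) (F' l)|

/-- A random function is pseudorandom if it is indistinguishable from a uniform one. -/
def PseudorandomFun (F : ∀ l : ℕ, PMF (Block l → Block l)) : Prop :=
  FunIndist F fun l => PMF.uniformOfFintype (Block l → Block l)

/-- A random sequence in `Y` is pseudorandom if no randomized distinguisher that is given its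
first `m l` terms, with `m` polynomially bounded, can tell them from independent uniform elements
of `Y l`, except with negligible advantage. Here `S l m` is the law of the first `m` terms. -/
def PseudorandomSeq {Y : ℕ → Type} [∀ l, Fintype (Y l)] [∀ l, Nonempty (Y l)]
    (S : ∀ l m : ℕ, PMF (Fin m → Y l)) : Prop :=
  ∀ (p : Polynomial ℕ) (m : ℕ → ℕ), (∀ l, m l ≤ p.eval l) →
    ∀ T : ∀ l : ℕ, (Fin (m l) → Y l) → PMF Bool,
      Negligible fun l =>
        |(((S l (m l)).bind (T l)) true).toReal -
          (((PMF.uniformOfFintype (Fin (m l) → Y l)).bind (T l)) true).toReal|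

/-- A random choice of functions `h` has negligible differentials: the probability
that `h x ⊕ h y = z` is negligible, uniformly in all `z` and all distinct `x`, `y`. -/
def NegligibleDifferentials (H : ∀ l : ℕ, PMF (Block l → Block l)) : Prop :=
  ∃ ε : ℕ → ℝ, Negligible ε ∧ ∀ (l : ℕ) (x y z : Block l), x ≠ y →
    (((H l).map fun h => h x ^^^ h y) z).toReal ≤ ε l

/-- The law of the first `m` outputs of the two-step counter-assisted generator with output
function `D_g ∘ D_g ∘ D_h`, for independent `g` and `h` with laws `g` and `h`. -/
def hashFeistelOutput {l : ℕ} (g h : PMF (Block l → Block l))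
    (op : Block l → Block l → Block l) (f : Block l → Block l) (x₀ : Block l) (m : ℕ) :
    PMF (Fin m → Block l × Block l) :=
  g.bind fun γ => h.map fun η =>
    twoStepOutput op f (feistel γ ∘ feistel γ ∘ feistel η) x₀ m

end CounterAssisted

end

/-!
The counter makes the states `(x_{2i}, x_{2i+1})` of the generator distinct during a full period of
`2 ^ l` steps: if two states agree, then `f x_{2i}` and `x_{2i+1} = f x_{2i} ⋆ i` agree, and the
Latin square property returns the counter value (`injective_twoStepState`). The outputs are
therefore the values of `D_g ∘ D_g ∘ D_h` at distinct inputs `(L, R)`, and the first round turns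
them into pairs `(R, V)` with `V = L ⊕ h R`.

* Two inputs with the same `R` have different `V`, and for different `R` the blocks `V` coincide
  with probability at most `ε` when `h` is drawn from `H`. So the `m` blocks `V` fail to be distinct
  with probability at most `m² ε` (`prob_not_injective_feistel_snd_le`). Such a collision is visible
  with `m` queries to `h`, so that it is also rare for a function indistinguishable from `H`.
* Suppose that `g` is uniform and the blocks `V` are distinct. The output on `(R, V)` is
  `(W, V ⊕ g W)` with `W = R ⊕ g V`. Prescribing an output vector means prescribing `g` at the blocks
  `V` and at the left halves `W` of the outputs. If these `2m` blocks are distinct, the probability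
  is exactly that of the uniform distribution (`toReal_map_feistel_feistel_apply`), and only a
  fraction of at most `2m² / 2 ^ l` of all output vectors violates this (`prob_uniform_not_injective_le`).
  Comparing masses on the good vectors, for a test and for its complement, bounds the advantage
  (`abs_prob_feistel_feistel_sub_le`).
* The true `g` is replaced by a uniform one by an adversary that draws `h` itself and makes two
  queries per output. Oracle algorithms are deterministic up to one initial random choice, whereas
  the distinguisher of sequences is randomized after seeing its input; it is first replaced by the
  best deterministic test (`exists_abs_expect_sub_le`).
-/

namespace CounterAssisted

/-! ### Finite expectations -/

section Expectation

variable {α β : Type*} [Fintype α] [Fintype β]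

/-- The expectation of a real function on a finite type, under a probability mass function. -/
noncomputable def expect (P : PMF α) (F : α → ℝ) : ℝ :=
  ∑ a, (P a).toReal * F a

/-- The probability of an event on a finite type, as a real number. -/
noncomputable def prob (P : PMF α) (s : Set α) : ℝ :=
  expect P (s.indicator 1)

theorem sum_toReal_eq_one (P : PMF α) : ∑ a, (P a).toReal = 1 := by
  rw [← ENNReal.toReal_sum fun a _ => P.apply_ne_top a, ← tsum_fintype (L := .unconditional _),
    P.tsum_coe, ENNReal.toReal_one]

theorem expect_const (P : PMF α) (c : ℝ) : expect P (fun _ => c) = c := by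
  rw [expect, ← Finset.sum_mul, sum_toReal_eq_one, one_mul]

theorem expect_mono (P : PMF α) {F G : α → ℝ} (h : ∀ a, F a ≤ G a) :
    expect P F ≤ expect P G :=
  Finset.sum_le_sum fun a _ => mul_le_mul_of_nonneg_left (h a) ENNReal.toReal_nonneg

theorem expect_add (P : PMF α) (F G : α → ℝ) :
    expect P (fun a => F a + G a) = expect P F + expect P G := by
  simp only [expect, mul_add, Finset.sum_add_distrib]

theorem expect_sub (P : PMF α) (F G : α → ℝ) :
    expect P (fun a => F a - G a) = expect P F - expect P G := by
  simp only [expect, mul_sub, Finset.sum_sub_distrib]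

theorem abs_expect_le (P : PMF α) (F : α → ℝ) : |expect P F| ≤ expect P fun a => |F a| := by
  refine (Finset.abs_sum_le_sum_abs _ _).trans_eq (Finset.sum_congr rfl fun a _ => ?_)
  rw [abs_mul, abs_of_nonneg ENNReal.toReal_nonneg]

theorem expect_comm (P : PMF α) (Q : PMF β) (F : α → β → ℝ) :
    (expect P fun a => expect Q (F a)) = expect Q fun b => expect P fun a => F a b := by
  simp only [expect, Finset.mul_sum]
  rw [Finset.sum_comm]
  exact Finset.sum_congr rfl fun b _ => Finset.sum_congr rfl fun a _ => by ring

theorem toReal_bind_apply {γ : Type*} (P : PMF α) (K : α → PMF γ) (c : γ) :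
    ((P.bind K) c).toReal = expect P fun a => (K a c).toReal := by
  rw [PMF.bind_apply, tsum_fintype,
    ENNReal.toReal_sum fun a _ => ENNReal.mul_ne_top (P.apply_ne_top a) ((K a).apply_ne_top c)]
  simp only [expect, ENNReal.toReal_mul]

theorem expect_bind (P : PMF α) (K : α → PMF β) (F : β → ℝ) :
    expect (P.bind K) F = expect P fun a => expect (K a) F := by
  simp only [expect, toReal_bind_apply, Finset.sum_mul, Finset.mul_sum]
  rw [Finset.sum_comm]
  exact Finset.sum_congr rfl fun b _ => Finset.sum_congr rfl fun a _ => by ring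

theorem expect_pure (a : α) (F : α → ℝ) : expect (PMF.pure a) F = F a := by
  classical
  rw [expect, Finset.sum_eq_single a]
  · simp
  · intro b _ hb
    simp [PMF.pure_apply_of_ne _ _ hb]
  · simp

theorem expect_map (P : PMF α) (e : α → β) (F : β → ℝ) :
    expect (P.map e) F = expect P fun a => F (e a) := by
  rw [← PMF.bind_pure_comp, expect_bind]
  simp only [Function.comp_apply, expect_pure]

theorem toReal_map_apply {γ : Type*} (P : PMF α) (e : α → γ) (c : γ) :
    ((P.map e) c).toReal = prob P {a | e a = c} := by
  classical
  rw [← PMF.bind_pure_comp, toReal_bind_apply, prob]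
  congr 1
  funext a
  simp only [Function.comp_apply, PMF.pure_apply, Set.indicator_apply, Set.mem_ofPred_eq, eq_comm,
    Pi.one_apply]
  split <;> simp

theorem prob_map (P : PMF α) (e : α → β) (s : Set β) :
    prob (P.map e) s = prob P (e ⁻¹' s) :=
  expect_map P e _

theorem prob_nonneg (P : PMF α) (s : Set α) : 0 ≤ prob P s :=
  Finset.sum_nonneg fun a _ => mul_nonneg ENNReal.toReal_nonneg
    (Set.indicator_nonneg (fun _ _ => zero_le_one) a)

theorem prob_mono (P : PMF α) {s t : Set α} (h : s ⊆ t) : prob P s ≤ prob P t :=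
  expect_mono P fun a => Set.indicator_le_indicator_of_subset h (fun _ => zero_le_one) a

theorem prob_empty (P : PMF α) : prob P ∅ = 0 := by
  simp [prob, expect]

theorem prob_univ (P : PMF α) : prob P Set.univ = 1 := by
  simp [prob, expect, sum_toReal_eq_one]

theorem prob_compl (P : PMF α) (s : Set α) : prob P sᶜ = 1 - prob P s := by
  rw [← prob_univ P, prob, prob, prob, ← expect_sub]
  congr 1
  funext a
  by_cases h : a ∈ s <;> simp [h]

theorem prob_le_one (P : PMF α) (s : Set α) : prob P s ≤ 1 :=
  (prob_mono P (Set.subset_univ s)).trans_eq (prob_univ P)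

theorem abs_prob_sub_prob_le_one (P : PMF α) (Q : PMF β) (s : Set α) (t : Set β) :
    |prob P s - prob Q t| ≤ 1 := by
  rw [abs_le]
  constructor <;> linarith [prob_nonneg P s, prob_nonneg Q t, prob_le_one P s, prob_le_one Q t]

theorem prob_union_le (P : PMF α) (s t : Set α) : prob P (s ∪ t) ≤ prob P s + prob P t := by
  rw [prob, prob, prob, ← expect_add]
  refine expect_mono P fun a => ?_
  by_cases hs : a ∈ s <;> by_cases ht : a ∈ t <;> simp [hs, ht]

theorem prob_iUnion_le {ι : Type*} [Fintype ι] (P : PMF α) (s : ι → Set α) :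
    prob P (⋃ i, s i) ≤ ∑ i, prob P (s i) := by
  have hsum : ∑ i, prob P (s i) = expect P fun a => ∑ i, (s i).indicator 1 a := by
    simp only [prob, expect, Finset.mul_sum]
    exact Finset.sum_comm
  rw [hsum]
  refine expect_mono P fun a => ?_
  have hnn : ∀ i ∈ Finset.univ, (0 : ℝ) ≤ (s i).indicator 1 a := fun i _ =>
    Set.indicator_nonneg (fun _ _ => zero_le_one) a
  by_cases ha : a ∈ ⋃ i, s i
  · obtain ⟨i, hi⟩ := Set.mem_iUnion.1 ha
    rw [Set.indicator_of_mem ha]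
    calc (1 : α → ℝ) a = (s i).indicator 1 a := (Set.indicator_of_mem hi _).symm
      _ ≤ _ := Finset.single_le_sum hnn (Finset.mem_univ i)
  · rw [Set.indicator_of_notMem ha]
    exact Finset.sum_nonneg hnn

theorem prob_iUnion_iUnion_le {m : ℕ} (P : PMF α) (s : Fin m → Fin m → Set α) {c : ℝ}
    (h : ∀ i j, prob P (s i j) ≤ c) : prob P (⋃ i, ⋃ j, s i j) ≤ (m : ℝ) ^ 2 * c := by
  calc prob P (⋃ i, ⋃ j, s i j) ≤ ∑ i, prob P (⋃ j, s i j) := prob_iUnion_le P _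
    _ ≤ ∑ i, ∑ j, prob P (s i j) := Finset.sum_le_sum fun i _ => prob_iUnion_le P _
    _ ≤ ∑ _i : Fin m, ∑ _j : Fin m, c :=
        Finset.sum_le_sum fun i _ => Finset.sum_le_sum fun j _ => h i j
    _ = (m : ℝ) ^ 2 * c := by simp; ring

theorem prob_uniformOfFintype [Nonempty α] (s : Set α) [DecidablePred (· ∈ s)] :
    prob (PMF.uniformOfFintype α) s =
      (Finset.univ.filter (· ∈ s)).card / (Fintype.card α : ℝ) := by
  simp only [prob, expect, PMF.uniformOfFintype_apply, Set.indicator_apply, Pi.one_apply,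
    ENNReal.toReal_inv, ENNReal.toReal_natCast]
  rw [← Finset.mul_sum, Finset.sum_boole, div_eq_inv_mul]

/-- A randomized test is no better than the best deterministic one: the event that one law gives
a larger mass than the other does at least as well. -/
theorem exists_abs_expect_sub_le (P Q : PMF α) (F : α → ℝ) (h0 : ∀ a, 0 ≤ F a)
    (h1 : ∀ a, F a ≤ 1) : ∃ s : Set α, |expect P F - expect Q F| ≤ |prob P s - prob Q s| := by
  -- For `s = {a | Q' a ≤ P' a}`, each term of the sum on the left is at most that on the right.
  have key : ∀ P' Q' : PMF α, ∃ s : Set α,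
      expect P' F - expect Q' F ≤ prob P' s - prob Q' s := by
    intro P' Q'
    refine ⟨{a | (Q' a).toReal ≤ (P' a).toReal}, ?_⟩
    simp only [prob, expect, ← Finset.sum_sub_distrib, ← sub_mul]
    refine Finset.sum_le_sum fun a _ => ?_
    by_cases ha : (Q' a).toReal ≤ (P' a).toReal
    · rw [Set.indicator_of_mem (by exact ha)]
      exact mul_le_mul_of_nonneg_left (h1 a) (sub_nonneg.2 ha)
    · rw [Set.indicator_of_notMem (by exact ha), mul_zero]
      exact mul_nonpos_of_nonpos_of_nonneg (by linarith) (h0 a)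
  rcases le_total (expect Q F) (expect P F) with h | h
  · obtain ⟨s, hs⟩ := key P Q
    exact ⟨s, by rw [abs_of_nonneg (sub_nonneg.2 h)]; exact hs.trans (le_abs_self _)⟩
  · obtain ⟨s, hs⟩ := key Q P
    refine ⟨s, ?_⟩
    rw [abs_sub_comm, abs_sub_comm (prob P s), abs_of_nonneg (sub_nonneg.2 h)]
    exact hs.trans (le_abs_self _)

end Expectation

/-! ### Query complexity -/

section Queries

variable {X Y Z : Type}

/-- The bit `F φ` can be computed by an adaptive algorithm making at most `q` queries to `φ`. -/
def DecidedByQueries (q : ℕ) (F : (X → Y) → Bool) : Prop :=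
  ∃ a : OracleAlg X Y q, ∀ φ, a.run φ = F φ

/-- The value `e φ` can be computed with `k` queries to `φ`, stated in continuation-passing style:
a bit that takes `q` further queries once the value is known takes `q + k` queries in all. -/
def ComputedByQueries (k : ℕ) (e : (X → Y) → Z) : Prop :=
  ∀ (q : ℕ) (K : Z → (X → Y) → Bool), (∀ z, DecidedByQueries q (K z)) →
    DecidedByQueries (q + k) fun φ => K (e φ) φ

theorem decidedByQueries_const (q : ℕ) (b : Bool) :
    DecidedByQueries q fun _ : X → Y => b :=
  ⟨.output b, fun _ => rfl⟩

theorem computedByQueries_apply (x : X) : ComputedByQueries 1 fun φ : X → Y => φ x := by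
  intro q K hK
  choose a ha using hK
  exact ⟨.query x a, fun φ => ha (φ x) φ⟩

theorem ComputedByQueries.pi {k m : ℕ} {e : Fin m → (X → Y) → Z}
    (he : ∀ i, ComputedByQueries k (e i)) :
    ComputedByQueries (m * k) fun φ i => e i φ := by
  induction m with
  | zero =>
    intro q K hK
    simp only [Nat.zero_mul, Nat.add_zero]
    have : (fun φ : X → Y => K (fun i => e i φ) φ) = K Fin.elim0 := by
      funext φ
      congr 1
      funext i
      exact i.elim0
    rw [this]
    exact hK _
  | succ m ih =>
    intro q K hK
    have h := he 0 (q + m * k) (fun z φ => K (Fin.cons z fun i => e i.succ φ) φ) fun z =>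
      ih (fun i => he i.succ) q (fun v => K (Fin.cons z v)) fun v => hK _
    have hq : q + (m + 1) * k = q + m * k + k := by ring
    have hfun : (fun φ => K (fun i => e i φ) φ) =
        fun φ => K (Fin.cons (e 0 φ) fun i => e i.succ φ) φ := by
      funext φ
      congr 1
      exact (Fin.cons_self_tail fun i => e i φ).symm
    rw [hq, hfun]
    exact h

theorem ComputedByQueries.decided {k q : ℕ} {e : (X → Y) → Z} (he : ComputedByQueries k e)
    (hk : k ≤ q) (F : Z → Bool) : DecidedByQueries q fun φ => F (e φ) := by
  have h := he (q - k) (fun z _ => F z) fun z => decidedByQueries_const _ _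
  rwa [Nat.sub_add_cancel hk] at h

/-- Two queries to `γ` suffice for two rounds of the Feistel permutation. -/
theorem computedByQueries_feistel_feistel {l : ℕ} (s : Block l × Block l) :
    ComputedByQueries 2 fun γ : Block l → Block l => feistel γ (feistel γ s) := by
  intro q K hK
  exact computedByQueries_apply s.2 (q + 1)
    (fun y γ => K (s.1 ^^^ y, s.2 ^^^ γ (s.1 ^^^ y)) γ) fun y =>
      computedByQueries_apply (s.1 ^^^ y) q (fun w => K (s.1 ^^^ y, s.2 ^^^ w)) fun w => hK _

/-- An algorithm that chooses a deterministic one by drawing `c` from `P`. -/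
theorem acceptProb_map {α : Type} [Fintype α] [Fintype (X → Y)] {q : ℕ} (P : PMF α)
    (A : α → OracleAlg X Y q) (F : PMF (X → Y)) :
    acceptProb (P.map A) F = expect P fun c => prob F {φ | (A c).run φ = true} := by
  rw [acceptProb, PMF.bind_map, toReal_bind_apply]
  simp only [Function.comp_apply, toReal_map_apply]

/-- Indistinguishability for tests that are given as `q`-query predicates depending on an
independent random value. -/
theorem FunIndist.negligible {F F' : ∀ l : ℕ, PMF (Block l → Block l)} (hF : FunIndist F F')
    (p : Polynomial ℕ) {C : ℕ → Type} [∀ l, Fintype (C l)] (P : ∀ l, PMF (C l))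
    (K : ∀ l, C l → (Block l → Block l) → Bool)
    (hK : ∀ l c, DecidedByQueries (p.eval l) (K l c)) :
    Negligible fun l => |(expect (P l) fun c => prob (F l) {φ | K l c φ = true}) -
      expect (P l) fun c => prob (F' l) {φ | K l c φ = true}| := by
  choose a ha using hK
  have h := hF p fun l => (P l).map (a l)
  simpa only [acceptProb_map, ha] using h

end Queries

/-! ### Uniform random functions -/

section Uniform

open Classical in
/-- A uniform random function has independent uniform values at distinct points. -/
theorem prob_uniform_comp_eq {X Y ι : Type*} [Fintype X] [Fintype Y] [Nonempty Y] [Fintype ι]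
    [DecidableEq X] {p : ι → X} (hp : Function.Injective p) (v : ι → Y) :
    prob (PMF.uniformOfFintype (X → Y)) {γ | γ ∘ p = v} =
      ((Fintype.card Y : ℝ) ^ Fintype.card ι)⁻¹ := by
  have hset : (Finset.univ.filter fun γ : X → Y => γ ∈ {γ : X → Y | γ ∘ p = v}) =
      Fintype.piFinset fun x => if h : ∃ i, p i = x then {v h.choose} else Finset.univ := by
    ext γ
    simp only [Finset.mem_filter, Finset.mem_univ, true_and, Set.mem_ofPred_eq,
      Fintype.mem_piFinset]
    constructor
    · rintro rfl x
      split_ifs with h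
      · rw [Finset.mem_singleton, Function.comp_apply, h.choose_spec]
      · exact Finset.mem_univ _
    · intro h
      funext i
      have hi : ∃ j, p j = p i := ⟨i, rfl⟩
      have := h (p i)
      rw [dif_pos hi, Finset.mem_singleton, hp hi.choose_spec] at this
      exact this
  have hcard : (Finset.univ.filter fun γ : X → Y => γ ∈ {γ : X → Y | γ ∘ p = v}).card *
      Fintype.card Y ^ Fintype.card ι = Fintype.card (X → Y) := by
    have hpt : ∀ x, (if h : ∃ i, p i = x then {v h.choose} else (Finset.univ : Finset Y)).card =
        if ∃ i, p i = x then 1 else Fintype.card Y := by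
      intro x
      split_ifs <;> simp
    rw [hset, Fintype.card_piFinset, Finset.prod_congr rfl fun x _ => hpt x, Finset.prod_ite,
      Finset.prod_const_one, one_mul, Finset.prod_const, ← pow_add, Fintype.card_fun]
    congr 1
    have himg : (Finset.univ.filter fun x => ∃ i, p i = x).card = Fintype.card ι := by
      rw [← Finset.card_univ, ← Finset.card_image_of_injective _ hp]
      congr 1
      ext x
      simp
    rw [← himg, add_comm, Finset.card_filter_add_card_filter_not, Finset.card_univ]
  have hY : (Fintype.card Y : ℝ) ≠ 0 := Nat.cast_ne_zero.2 Fintype.card_ne_zero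
  have hXY : (Fintype.card (X → Y) : ℝ) ≠ 0 := Nat.cast_ne_zero.2 Fintype.card_ne_zero
  rw [prob_uniformOfFintype, div_eq_iff hXY, ← hcard]
  push_cast
  field_simp

open Classical in
/-- In a uniform random vector of pairs, the first component of an entry hits a given value with
probability `1 / |B|`, even if that value depends on the other entries. -/
theorem prob_uniform_fst_eq_le {B C ι : Type*} [Fintype B] [Fintype C] [Nonempty B] [Nonempty C]
    [Fintype ι] [DecidableEq ι] (i : ι) (e : (ι → B × C) → B)
    (he : ∀ y z, e (Function.update y i z) = e y) :
    prob (PMF.uniformOfFintype (ι → B × C)) {y | (y i).1 = e y} ≤ (Fintype.card B : ℝ)⁻¹ := by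
  -- Changing the first component of entry `i` to an arbitrary value is injective on the event.
  have hcard : (Finset.univ.filter fun y => y ∈ {y : ι → B × C | (y i).1 = e y}).card *
      Fintype.card B ≤ Fintype.card (ι → B × C) := by
    rw [← Finset.card_univ (α := B), ← Finset.card_product, ← Finset.card_univ]
    refine Finset.card_le_card_of_injOn
      (fun q => Function.update q.1 i (q.2, (q.1 i).2)) (fun _ _ => Finset.mem_univ _) ?_
    rintro ⟨y, c⟩ hy ⟨y', c'⟩ hy' h
    simp only [Finset.coe_product, Set.mem_prod, Finset.mem_coe, Finset.mem_filter,
      Finset.mem_univ, true_and, and_true, Set.mem_ofPred_eq] at hy hy' h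
    have hi := congrFun h i
    rw [Function.update_self, Function.update_self, Prod.mk.injEq] at hi
    have he' : e y = e y' := by rw [← he y (c, (y i).2), h, he]
    refine Prod.ext (funext fun j => ?_) hi.1
    by_cases hj : j = i
    · subst hj
      exact Prod.ext (by rw [hy, hy', he']) hi.2
    · have := congrFun h j
      rwa [Function.update_of_ne hj, Function.update_of_ne hj] at this
  have hB : (0 : ℝ) < Fintype.card B := Nat.cast_pos.2 Fintype.card_pos
  have hX : (0 : ℝ) < Fintype.card (ι → B × C) := Nat.cast_pos.2 Fintype.card_pos
  rw [prob_uniformOfFintype, div_le_iff₀ hX, inv_mul_eq_div, le_div_iff₀ hB]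
  exact_mod_cast hcard

end Uniform

/-! ### Two Feistel rounds with a uniform random function -/

section Feistel

variable {l m : ℕ}

theorem card_block (l : ℕ) : Fintype.card (Block l) = 2 ^ l := by
  rw [Fintype.card_congr ⟨BitVec.toFin, BitVec.ofFin, fun _ => rfl, fun _ => rfl⟩,
    Fintype.card_fin]

theorem xor_eq_iff_eq_xor (a b c : Block l) : a ^^^ b = c ↔ b = a ^^^ c := by
  constructor
  · rintro rfl
    rw [← BitVec.xor_assoc, BitVec.xor_self, BitVec.zero_xor]
  · rintro rfl
    rw [← BitVec.xor_assoc, BitVec.xor_self, BitVec.zero_xor]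

/-- The event that two Feistel rounds send the inputs `s` to the outputs `y` prescribes the values
of the round function at the right halves of `s` and at the left halves of `y`. -/
theorem feistel_feistel_eq_iff (γ : Block l → Block l) (s y : Fin m → Block l × Block l) :
    (fun i => feistel γ (feistel γ (s i))) = y ↔
      γ ∘ Sum.elim (fun i => (s i).2) (fun i => (y i).1) =
        Sum.elim (fun i => (s i).1 ^^^ (y i).1) (fun i => (s i).2 ^^^ (y i).2) := by
  simp only [funext_iff, Sum.forall, Function.comp_apply, Sum.elim_inl, Sum.elim_inr,
    ← forall_and, feistel, Prod.ext_iff]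
  refine forall_congr' fun i => ?_
  rw [xor_eq_iff_eq_xor, ← xor_eq_iff_eq_xor (s i).2]
  refine and_congr_right fun h => ?_
  rw [h, ← BitVec.xor_assoc, BitVec.xor_self, BitVec.zero_xor]

/-- A uniform output vector is bad with small probability: its left halves are rarely equal to each
other or to one of the given blocks. -/
theorem prob_uniform_not_injective_le {b : Fin m → Block l} (hb : Function.Injective b) :
    prob (PMF.uniformOfFintype (Fin m → Block l × Block l))
        {y | ¬ Function.Injective (Sum.elim b fun i => (y i).1)} ≤
      (m : ℝ) ^ 2 * (2 * (2⁻¹ : ℝ) ^ l) := by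
  have hone : ∀ (i : Fin m) (e : (Fin m → Block l × Block l) → Block l),
      (∀ y z, e (Function.update y i z) = e y) →
      prob (PMF.uniformOfFintype (Fin m → Block l × Block l)) {y | (y i).1 = e y} ≤
        (2⁻¹ : ℝ) ^ l := by
    intro i e he
    refine (prob_uniform_fst_eq_le i e he).trans_eq ?_
    rw [card_block]
    push_cast
    rw [inv_pow]
  have hsub : {y : Fin m → Block l × Block l |
      ¬ Function.Injective (Sum.elim b fun i => (y i).1)} ⊆
      ⋃ i, ⋃ j, ({y | (y i).1 = b j} ∪ {y | i ≠ j ∧ (y i).1 = (y j).1}) := by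
    intro y hy
    by_contra hcon
    simp only [Set.mem_union, Set.mem_ofPred_eq, Set.mem_iUnion, not_or, not_exists] at hcon hy
    refine hy (hb.sumElim ?_ ?_)
    · intro i j hij
      by_contra hne
      exact (hcon i j).2 ⟨hne, hij⟩
    · exact fun i j h => (hcon j i).1 h.symm
  refine (prob_mono _ hsub).trans ?_
  refine prob_iUnion_iUnion_le _ _ fun i j => (prob_union_le _ _ _).trans ?_
  rw [two_mul]
  refine add_le_add (hone i (fun _ => b j) fun _ _ => rfl) ?_
  by_cases hij : i = j
  · simp only [hij, ne_eq, not_true_eq_false, false_and, Set.ofPred_false, prob_empty]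
    positivity
  · refine (prob_mono _ fun y hy => hy.2).trans (hone i (fun y => (y j).1) fun y z => ?_)
    rw [Function.update_of_ne (Ne.symm hij)]

/-- Output vectors without collisions are exactly as likely for two Feistel rounds with a uniform
round function as for the uniform distribution. -/
theorem toReal_map_feistel_feistel_apply (s y : Fin m → Block l × Block l)
    (hy : Function.Injective (Sum.elim (fun i => (s i).2) fun i => (y i).1)) :
    (((PMF.uniformOfFintype (Block l → Block l)).map
      fun γ i => feistel γ (feistel γ (s i))) y).toReal =
      ((PMF.uniformOfFintype (Fin m → Block l × Block l)) y).toReal := by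
  simp only [toReal_map_apply, feistel_feistel_eq_iff, prob_uniform_comp_eq hy]
  rw [PMF.uniformOfFintype_apply, ENNReal.toReal_inv, ENNReal.toReal_natCast]
  simp only [Fintype.card_fun, Fintype.card_prod, Fintype.card_sum, Fintype.card_fin]
  push_cast
  rw [pow_add, mul_pow]

/-- Two Feistel rounds with a uniform random round function turn inputs with distinct right halves
into nearly uniform outputs. -/
theorem abs_prob_feistel_feistel_sub_le (s : Fin m → Block l × Block l)
    (hs : Function.Injective fun i => (s i).2) (S : Set (Fin m → Block l × Block l)) :
    |prob ((PMF.uniformOfFintype (Block l → Block l)).map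
        fun γ i => feistel γ (feistel γ (s i))) S -
      prob (PMF.uniformOfFintype (Fin m → Block l × Block l)) S| ≤
      (m : ℝ) ^ 2 * (2 * (2⁻¹ : ℝ) ^ l) := by
  set P := (PMF.uniformOfFintype (Block l → Block l)).map
    fun γ i => feistel γ (feistel γ (s i))
  set U := PMF.uniformOfFintype (Fin m → Block l × Block l)
  set bad := {y : Fin m → Block l × Block l |
    ¬ Function.Injective (Sum.elim (fun i => (s i).2) fun i => (y i).1)}
  have hbad : prob U bad ≤ (m : ℝ) ^ 2 * (2 * (2⁻¹ : ℝ) ^ l) :=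
    prob_uniform_not_injective_le hs
  -- One inequality suffices, because it can be applied to the complement as well.
  have key : ∀ S, prob U S - prob P S ≤ (m : ℝ) ^ 2 * (2 * (2⁻¹ : ℝ) ^ l) := by
    intro S
    have hgood : prob U (S \ bad) = prob P (S \ bad) := by
      refine Finset.sum_congr rfl fun y _ => ?_
      by_cases hy : y ∈ S \ bad
      · rw [toReal_map_feistel_feistel_apply s y (not_not.1 hy.2)]
      · simp only [Set.indicator_of_notMem hy, mul_zero]
    have h1 : prob U S ≤ prob U (S \ bad) + prob U bad :=
      (prob_mono U (by rw [Set.sdiff_union_self]; exact Set.subset_union_left)).trans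
        (prob_union_le U _ _)
    have h2 : prob P (S \ bad) ≤ prob P S := prob_mono P Set.sdiff_subset
    linarith
  rw [abs_le]
  have h := key Sᶜ
  rw [prob_compl, prob_compl] at h
  constructor <;> linarith [key S]

end Feistel

/-! ### Generator states and the first round -/

section FirstRound

variable {l m : ℕ}

theorem twoStepState_snd (op : Block l → Block l → Block l) (f : Block l → Block l)
    (x₀ : Block l) (i : ℕ) :
    (twoStepState op f x₀ i).2 = op (f (twoStepState op f x₀ i).1) (BitVec.ofNat l i) := by
  cases i <;> rfl

/-- The counter makes the states distinct throughout a full period: the left half of a state and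
its right half determine the counter value. -/
theorem injective_twoStepState {op : Block l → Block l → Block l} (hop : IsLatinSquare op)
    (f : Block l → Block l) (x₀ : Block l) (hm : m ≤ 2 ^ l) :
    Function.Injective fun i : Fin m => twoStepState op f x₀ i := by
  intro i j hij
  have h := congrArg Prod.snd hij
  have h1 := congrArg Prod.fst hij
  simp only at h h1
  rw [twoStepState_snd, twoStepState_snd, h1] at h
  have hc := congrArg BitVec.toNat ((hop.bijective_left _).1 h)
  rw [BitVec.toNat_ofNat, BitVec.toNat_ofNat, Nat.mod_eq_of_lt (i.2.trans_le hm),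
    Nat.mod_eq_of_lt (j.2.trans_le hm)] at hc
  exact Fin.ext hc

/-- A first Feistel round with small differentials rarely makes the right halves collide. -/
theorem prob_not_injective_feistel_snd_le (H : PMF (Block l → Block l)) {ε : ℝ}
    (hε : 0 ≤ ε)
    (hH : ∀ x y z : Block l, x ≠ y → ((H.map fun h => h x ^^^ h y) z).toReal ≤ ε)
    {s : Fin m → Block l × Block l} (hs : Function.Injective s) :
    prob H {η | ¬ Function.Injective fun i => (feistel η (s i)).2} ≤ (m : ℝ) ^ 2 * ε := by
  have hsub : {η : Block l → Block l | ¬ Function.Injective fun i => (feistel η (s i)).2} ⊆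
      ⋃ i, ⋃ j, {η | i ≠ j ∧ (feistel η (s i)).2 = (feistel η (s j)).2} := by
    intro η hη
    obtain ⟨i, j, hij, hne⟩ := Function.not_injective_iff.1 hη
    exact Set.mem_iUnion₂.2 ⟨i, j, hne, hij⟩
  refine (prob_mono _ hsub).trans (prob_iUnion_iUnion_le _ _ fun i j => ?_)
  by_cases hR : (s i).2 = (s j).2
  · -- Equal right halves come with distinct left halves, so that there is no collision.
    have hem : {η : Block l → Block l | i ≠ j ∧ (feistel η (s i)).2 = (feistel η (s j)).2} = ∅ := by
      refine Set.eq_empty_of_forall_notMem fun η hη => hη.1 (hs (Prod.ext ?_ hR))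
      have h := hη.2
      simp only [feistel, hR] at h
      exact BitVec.xor_left_inj _ |>.1 h
    rw [hem, prob_empty]
    exact hε
  · refine le_trans ?_ (hH _ _ ((s i).1 ^^^ (s j).1) hR)
    rw [toReal_map_apply]
    refine prob_mono _ fun η hη => ?_
    have h := hη.2
    simp only [feistel] at h
    rw [xor_eq_iff_eq_xor] at h
    rw [Set.mem_ofPred_eq, h]
    simp only [BitVec.xor_assoc, BitVec.xor_self, BitVec.xor_zero]

end FirstRound

/-! ### Security of the generator -/

section Security

variable {l m : ℕ}

theorem prob_hashFeistelOutput (g h : PMF (Block l → Block l))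
    (op : Block l → Block l → Block l) (f : Block l → Block l) (x₀ : Block l)
    (S : Set (Fin m → Block l × Block l)) :
    prob (hashFeistelOutput g h op f x₀ m) S =
      expect h fun η => prob g
        {γ | twoStepOutput op f (feistel γ ∘ feistel γ ∘ feistel η) x₀ m ∈ S} := by
  rw [prob, hashFeistelOutput, expect_bind]
  simp only [expect_map]
  exact expect_comm g h _

/-- The output vector of the generator takes two queries per entry to the round function `g`. -/
theorem decidedByQueries_twoStepOutput (op : Block l → Block l → Block l)
    (f η : Block l → Block l) (x₀ : Block l) {q : ℕ} (hq : m * 2 ≤ q)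
    (F : (Fin m → Block l × Block l) → Bool) :
    DecidedByQueries q fun γ : Block l → Block l =>
      F (twoStepOutput op f (feistel γ ∘ feistel γ ∘ feistel η) x₀ m) :=
  (ComputedByQueries.pi fun i : Fin m =>
    computedByQueries_feistel_feistel (feistel η (twoStepState op f x₀ i))).decided hq F

/-- A collision among the right halves after the first Feistel round takes one query per entry. -/
theorem decidedByQueries_feistel_snd (s : Fin m → Block l × Block l) {q : ℕ} (hq : m ≤ q)
    (F : (Fin m → Block l) → Bool) :
    DecidedByQueries q fun η : Block l → Block l => F fun i => (feistel η (s i)).2 :=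
  (ComputedByQueries.pi fun i : Fin m => computedByQueries_apply (s i).2).decided
    (by rwa [mul_one]) fun v => F fun i => (s i).1 ^^^ v i

/-- The generator with a uniform `g`: a test gains an advantage only through a collision after the first
round, or a collision in a uniform output vector. The law `H` of the ideal first round function
may be used in place of `h` to estimate the former. -/
theorem abs_prob_hashFeistelOutput_uniform_sub_le (h H : PMF (Block l → Block l)) {ε : ℝ}
    (hε : 0 ≤ ε)
    (hH : ∀ x y z : Block l, x ≠ y → ((H.map fun h => h x ^^^ h y) z).toReal ≤ ε)
    {op : Block l → Block l → Block l} (hop : IsLatinSquare op) (f : Block l → Block l)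
    (x₀ : Block l) (S : Set (Fin m → Block l × Block l)) :
    |prob (hashFeistelOutput (PMF.uniformOfFintype (Block l → Block l)) h op f x₀ m) S -
      prob (PMF.uniformOfFintype (Fin m → Block l × Block l)) S| ≤
      |prob h {η | ¬ Function.Injective fun i : Fin m => (feistel η (twoStepState op f x₀ i)).2} -
        prob H {η | ¬ Function.Injective fun i : Fin m =>
          (feistel η (twoStepState op f x₀ i)).2}| +
      (m : ℝ) ^ 2 * (ε + 2 * (2⁻¹ : ℝ) ^ l) := by
  set coll := {η : Block l → Block l |
    ¬ Function.Injective fun i : Fin m => (feistel η (twoStepState op f x₀ i)).2}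
  set δ := (m : ℝ) ^ 2 * (2 * (2⁻¹ : ℝ) ^ l) with hδ
  have hδ0 : 0 ≤ δ := by positivity
  rcases le_or_gt m (2 ^ l) with hm | hm
  · have hcoll : prob H coll ≤ (m : ℝ) ^ 2 * ε :=
      prob_not_injective_feistel_snd_le H hε hH (injective_twoStepState hop f x₀ hm)
    have hadd : prob h coll + δ = expect h fun η => coll.indicator 1 η + δ := by
      rw [expect_add, expect_const, prob]
    have hmain : |prob (hashFeistelOutput (PMF.uniformOfFintype (Block l → Block l))
          h op f x₀ m) S - prob (PMF.uniformOfFintype (Fin m → Block l × Block l)) S| ≤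
        prob h coll + δ := by
      rw [prob_hashFeistelOutput,
        ← expect_const h (prob (PMF.uniformOfFintype (Fin m → Block l × Block l)) S),
        ← expect_sub, hadd]
      refine (abs_expect_le _ _).trans (expect_mono _ fun η => ?_)
      by_cases hη : η ∈ coll
      · rw [Set.indicator_of_mem hη, Pi.one_apply]
        exact (abs_prob_sub_prob_le_one _ _ _ _).trans (by linarith)
      · rw [Set.indicator_of_notMem hη, zero_add]
        have := abs_prob_feistel_feistel_sub_le
          (fun i : Fin m => feistel η (twoStepState op f x₀ i)) (not_not.1 hη) S
        rwa [prob_map] at this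
    have habs := le_abs_self (prob h coll - prob H coll)
    rw [mul_add, ← hδ]
    linarith
  · -- Beyond a full period the states repeat, but then the bound is at least `1`.
    refine (abs_prob_sub_prob_le_one _ _ _ _).trans ?_
    have hm' : (2 : ℝ) ^ l ≤ m := by exact_mod_cast hm.le
    have h1 : (1 : ℝ) ≤ 2 ^ l := one_le_pow₀ one_le_two
    have hmm : (2 : ℝ) ^ l * 1 ≤ (m : ℝ) ^ 2 := by
      rw [sq]
      exact mul_le_mul hm' (h1.trans hm') zero_le_one (Nat.cast_nonneg m)
    have hinv : (2 : ℝ) ^ l * (2⁻¹ : ℝ) ^ l = 1 := by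
      rw [← mul_pow, mul_inv_cancel₀ two_ne_zero, one_pow]
    have h2 : 1 ≤ δ := by
      have := mul_le_mul_of_nonneg_right hmm (by positivity : (0 : ℝ) ≤ (2⁻¹ : ℝ) ^ l)
      rw [mul_one, hinv] at this
      rw [hδ]
      linarith
    have h3 : 0 ≤ (m : ℝ) ^ 2 * ε := by positivity
    rw [mul_add, ← hδ]
    linarith [abs_nonneg (prob h coll - prob H coll)]

end Security

theorem negligible_two_inv_pow : Negligible fun l => (2⁻¹ : ℝ) ^ l := fun k =>
  tendsto_pow_const_mul_const_pow_of_abs_lt_one k (by norm_num [abs_of_pos])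

theorem Negligible.eval_sq_mul {ε : ℕ → ℝ} (hε : Negligible ε) (p : Polynomial ℕ) :
    Negligible fun l => ((p.eval l : ℕ) : ℝ) ^ 2 * ε l := by
  have h := SuperpolynomialDecay.polynomial_mul hε ((p ^ 2).map (Nat.castRingHom ℝ))
  refine h.congr fun l => ?_
  rw [Polynomial.eval_natCast_map, Polynomial.eval_pow]
  simp

theorem Negligible.abs {ε : ℕ → ℝ} (hε : Negligible ε) : Negligible fun l => |ε l| :=
  hε.trans_abs_le fun _ => (abs_abs _).le

end CounterAssisted

open CounterAssisted

theorem mainTheorem6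
    (g : ∀ l : ℕ, PMF (CounterAssisted.Block l → CounterAssisted.Block l))
    (hg : CounterAssisted.PseudorandomFun g)
    (H : ∀ l : ℕ, PMF (CounterAssisted.Block l → CounterAssisted.Block l))
    (hH : CounterAssisted.NegligibleDifferentials H)
    (h : ∀ l : ℕ, PMF (CounterAssisted.Block l → CounterAssisted.Block l))
    (hh : CounterAssisted.FunIndist h H)
    (op : ∀ l : ℕ, CounterAssisted.Block l → CounterAssisted.Block l → CounterAssisted.Block l)
    (hop : ∀ l, CounterAssisted.IsLatinSquare (op l))
    (f : ∀ l : ℕ, CounterAssisted.Block l → CounterAssisted.Block l)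
    (x₀ : ∀ l : ℕ, CounterAssisted.Block l) :
    CounterAssisted.PseudorandomSeq
      (Y := fun l => CounterAssisted.Block l × CounterAssisted.Block l)
      (fun l m => CounterAssisted.hashFeistelOutput (g l) (h l) (op l) (f l) (x₀ l) m) := by
  classical
  obtain ⟨ε, hε, hdiff⟩ := hH
  intro p m hm T
  choose S hS using fun l => exists_abs_expect_sub_le
    (hashFeistelOutput (g l) (h l) (op l) (f l) (x₀ l) (m l))
    (PMF.uniformOfFintype (Fin (m l) → Block l × Block l))
    (fun y => (T l y true).toReal) (fun _ => ENNReal.toReal_nonneg)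
    (fun y => ENNReal.toReal_le_of_le_ofReal zero_le_one
      (by rw [ENNReal.ofReal_one]; exact (T l y).coe_le_one true))
  have hm2 : ∀ l, m l * 2 ≤ (p * 2).eval l := fun l => by
    rw [Polynomial.eval_mul, Polynomial.eval_ofNat]
    exact Nat.mul_le_mul_right 2 (hm l)
  -- The distinguisher that draws `η` from `h` itself cannot tell `g` from a uniform function.
  have hN1 := FunIndist.negligible hg (p * 2) h
    (fun l η γ => decide
      (twoStepOutput (op l) (f l) (feistel γ ∘ feistel γ ∘ feistel η) (x₀ l) (m l) ∈ S l))
    fun l η => decidedByQueries_twoStepOutput (op l) (f l) η (x₀ l) (hm2 l)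
      fun y => decide (y ∈ S l)
  -- Collisions after the first round are as rare for `h` as they are for `H`.
  have hN2 := FunIndist.negligible hh p (C := fun _ => Unit) (fun _ => PMF.pure ())
    (fun l _ η => decide (¬ Function.Injective fun i : Fin (m l) =>
      (feistel η (twoStepState (op l) (f l) (x₀ l) i)).2))
    fun l _ => decidedByQueries_feistel_snd
      (fun i : Fin (m l) => twoStepState (op l) (f l) (x₀ l) i) (hm l)
      fun v => decide (¬ Function.Injective v)
  simp only [decide_eq_true_eq, expect_pure] at hN1 hN2
  have hN3 : Negligible fun l => ((p.eval l : ℕ) : ℝ) ^ 2 * (|ε l| + 2 * (2⁻¹ : ℝ) ^ l) :=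
    Negligible.eval_sq_mul (hε.abs.add (negligible_two_inv_pow.const_mul 2)) p
  refine SuperpolynomialDecay.trans_abs_le ((hN1.add hN2).add hN3) fun l => ?_
  refine le_trans ?_ (le_abs_self _)
  rw [abs_abs, toReal_bind_apply, toReal_bind_apply]
  refine (hS l).trans ((abs_sub_le _ (prob (hashFeistelOutput
    (PMF.uniformOfFintype (Block l → Block l)) (h l) (op l) (f l) (x₀ l) (m l)) (S l)) _).trans ?_)
  have hunif := abs_prob_hashFeistelOutput_uniform_sub_le (m := m l) (h l) (H l)
    (abs_nonneg (ε l)) (fun x y z hxy => (hdiff l x y z hxy).trans (le_abs_self _)) (hop l) (f l)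
    (x₀ l) (S l)
  have hpoly : (m l : ℝ) ^ 2 * (|ε l| + 2 * (2⁻¹ : ℝ) ^ l) ≤
      ((p.eval l : ℕ) : ℝ) ^ 2 * (|ε l| + 2 * (2⁻¹ : ℝ) ^ l) := by
    have : (m l : ℝ) ≤ (p.eval l : ℕ) := Nat.cast_le.2 (hm l)
    gcongr
  rw [prob_hashFeistelOutput (g l)]
  rw [prob_hashFeistelOutput (PMF.uniformOfFintype (Block l → Block l))] at hunif ⊢
  simp only [Pi.add_apply]
  linarith
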